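/- Let $\mathcal A$ be a finite alphabet and $\eta\colon\mathbb Z^2\to\mathcal A$. *Colorings.* For $S\subseteq\mathbb Z^2$, an $\eta$-coloring of $S$ is the restriction to $S$ of a translate $x\mapsto\eta(x+u)$ with $u\in\mathbb Z^2$; $P_\eta(S)$ is the number of $\eta$-colorings of $S$, and $P_\eta(n,k):=P_\eta(R_{n,k})$ for $R_{n,k}=\{(x,y)\in\mathbb Z^2: 0\le x<n,\ 0\le y<k\}$. For finite $S$ put $D_\eta(S)=P_\eta(S)-|S|$. For $T\subseteq S$, an $\eta$-coloring of $T$ extends uniquely to $S$ if it is the restriction to $T$ of exactly one $\eta$-coloring of $S$. *Generating sets.* A set $S\subseteq\mathbb Z^2$ is convex if $\mathrm{conv}(S)\subseteq\mathbb R^2$ is closed and $S=\mathrm{conv}(S)\cap\mathbb Z^2$. A finite, nonempty, convex set $S$ is $\eta$-generating if 1. for every extreme point $x$ of $\mathrm{conv}(S)$, every $\eta$-coloring of $S\setminus\{x\}$ extends uniquely to $S$; and 2. $D_\eta(T)>D_\eta(S)$ for every nonempty convex $T\subsetneq S$. The boundary edges of $S$ are the edges of the convex polygon $\mathrm{conv}(S)$,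 oriented counterclockwise; if $\mathrm{conv}(S)$ is a segment of positive length, its boundary edges are this segment with each of its two orientations. *One-sided nonexpansive directions.* Let $\ell$ be an oriented rational line through the origin, that is, the line spanned and oriented by a nonzero vector of $\mathbb Z^2$. It is one-sided $\eta$-expansive if there are integers $a,b\ge 1$ and a matrix $M\in SL_2(\mathbb Z)$ mapping the downward oriented $y$-axis to $\ell$ such that every $(\eta\circ M)$-coloring of $\{0,\dots,a\}\times\{-b,\dots,b\}$ extends uniquely to $(\{0,\dots,a\}\times\{-b,\dots,b\})\cup\{(-1,0)\}$. Otherwise $\ell$ is one-sided $\eta$-nonexpansive. **Lemma.** Suppose there exist $n,k\in\mathbb N$ such that $P_\eta(n,k)\le \frac{nk}{2}$. If the oriented rational line $\ell$ through the origin is one-sided $\eta$-nonexpansive, then so is the oppositely oriented (antiparallel) line. In particular, every $\eta$-generating set has a boundary edge parallel to $\ell$ and a boundary edge antiparallel to $\ell$, as oriented segments. -/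

import Mathlib

/-!
Colorings of the lattice of integer points of the plane.  A point of the lattice is a vector
`Fin 2 → ℤ` with coordinates `x 0` and `x 1`.
-/

open scoped Matrix

namespace PlaneColoring

/-- An integer point, seen as a point of the real plane. -/
def toReal (x : Fin 2 → ℤ) : Fin 2 → ℝ := fun i => (x i : ℝ)

/-- The convex hull, in the real plane, of a set of integer points. -/
def hull (S : Set (Fin 2 → ℤ)) : Set (Fin 2 → ℝ) := convexHull ℝ (toReal '' S)

/-- `S ⊆ ℤ²` is convex: its convex hull is closed, and `S` consists of all the integer points of
its convex hull. -/
def IsConvex (S : Set (Fin 2 → ℤ)) : Prop :=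
  IsClosed (hull S) ∧ S = {x | toReal x ∈ hull S}

/-- The extreme points (vertices) of `S`. -/
def vertices (S : Set (Fin 2 → ℤ)) : Set (Fin 2 → ℤ) :=
  {x | toReal x ∈ (hull S).extremePoints ℝ}

/-- The determinant of two vectors of the real plane; it is nonnegative iff `b` does not lie
strictly to the right of the line spanned and oriented by `a`. -/
def cross (a b : Fin 2 → ℝ) : ℝ := a 0 * b 1 - a 1 * b 0

/-- The segment from `p` to `q`, oriented from `p` to `q`, is a boundary edge of the finite convex
set `S` with its positive (counterclockwise) orientation: the hull of `S` lies to the left of the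
oriented line from `p` to `q`, and meets that line exactly in the segment with endpoints `p` and
`q`.  If the hull of `S` is a segment of positive length, its boundary is run through once in each
direction, that is, it has two edges, one for each orientation of the segment. -/
def IsBoundaryEdge (S : Set (Fin 2 → ℤ)) (p q : Fin 2 → ℤ) : Prop :=
  p ≠ q ∧
  (∀ z ∈ hull S, 0 ≤ cross (toReal q - toReal p) (z - toReal p)) ∧
  {z ∈ hull S | cross (toReal q - toReal p) (z - toReal p) = 0} = segment ℝ (toReal p) (toReal q)

/-- The rectangle `[0, n) × [0, k)` of integer points. -/
def rect (n k : ℕ) : Set (Fin 2 → ℤ) :=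
  {x | 0 ≤ x 0 ∧ x 0 < n ∧ 0 ≤ x 1 ∧ x 1 < k}

variable {A : Type*}

/-- The translate `T^u η`. -/
def shift (u : Fin 2 → ℤ) (η : (Fin 2 → ℤ) → A) : (Fin 2 → ℤ) → A := fun x => η (x + u)

/-- The `η`-colorings of `S`: the restrictions to `S` of the translates of `η`. -/
def colorings (η : (Fin 2 → ℤ) → A) (S : Set (Fin 2 → ℤ)) : Set (S → A) :=
  Set.range fun u => S.domRestrict (shift u η)

/-- The complexity `P_η(S)`: the number of `η`-colorings of `S`. -/
noncomputable def complexity (η : (Fin 2 → ℤ) → A) (S : Set (Fin 2 → ℤ)) : ℕ :=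
  (colorings η S).ncard

/-- The discrepancy `D_η(S) = P_η(S) - |S|`, for finite `S`. -/
noncomputable def discrepancy (η : (Fin 2 → ℤ) → A) (S : Set (Fin 2 → ℤ)) : ℤ :=
  (complexity η S : ℤ) - (S.ncard : ℤ)

/-- Every `η`-coloring of `T` extends uniquely to an `η`-coloring of `S ⊇ T`. -/
def AllExtendUniquely (η : (Fin 2 → ℤ) → A) {T S : Set (Fin 2 → ℤ)} (h : T ⊆ S) : Prop :=
  ∀ α ∈ colorings η T, ∃! β : S → A, β ∈ colorings η S ∧ Set.domRestrict₂ (π := fun _ => A) h β = α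

/-- The point `x` of `S` is `η`-generated by `S`. -/
def IsGenerated (η : (Fin 2 → ℤ) → A) (S : Set (Fin 2 → ℤ)) (x : Fin 2 → ℤ) : Prop :=
  AllExtendUniquely η (Set.sdiff_subset : S \ {x} ⊆ S)

/-- Weak `η`-generating sets: finite nonempty convex sets all of whose extreme points are
`η`-generated. -/
def IsWeakGenerating (η : (Fin 2 → ℤ) → A) (S : Set (Fin 2 → ℤ)) : Prop :=
  S.Finite ∧ S.Nonempty ∧ IsConvex S ∧ ∀ x ∈ vertices S, IsGenerated η S x

/-- `η`-generating sets: weak `η`-generating sets all of whose nonempty proper convex subsets have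
strictly larger discrepancy. -/
def IsGenerating (η : (Fin 2 → ℤ) → A) (S : Set (Fin 2 → ℤ)) : Prop :=
  IsWeakGenerating η S ∧
  ∀ T, T ⊂ S → T.Nonempty → IsConvex T → discrepancy η S < discrepancy η T

/-- The set `[0, a] × [-b, b]` of integer points. -/
def box (a b : ℕ) : Set (Fin 2 → ℤ) :=
  {x | 0 ≤ x 0 ∧ x 0 ≤ a ∧ -(b : ℤ) ≤ x 1 ∧ x 1 ≤ b}

/-- The oriented rational line through the origin spanned and oriented by the nonzero integer
vector `v` is one-sided `η`-expansive: for some positive integers `a`, `b` and some matrix `M` in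
`SL₂(ℤ)` that maps the downward oriented `y`-axis to this oriented line, every `(η ∘ M)`-coloring
of `[0, a] × [-b, b]` extends uniquely to an `(η ∘ M)`-coloring of
`([0, a] × [-b, b]) ∪ {(-1, 0)}`. -/
def OneSidedExpansive (η : (Fin 2 → ℤ) → A) (v : Fin 2 → ℤ) : Prop :=
  ∃ (a b : ℕ) (M : Matrix.SpecialLinearGroup (Fin 2) ℤ),
    0 < a ∧ 0 < b ∧
    SameRay ℤ (M.val *ᵥ ![0, -1]) v ∧
    AllExtendUniquely (fun x => η (M.val *ᵥ x))
      (Set.subset_union_left : box a b ⊆ box a b ∪ {![-1, 0]})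

/-- The oriented rational line spanned and oriented by `v` is one-sided `η`-nonexpansive. -/
def OneSidedNonexpansive (η : (Fin 2 → ℤ) → A) (v : Fin 2 → ℤ) : Prop :=
  ¬ OneSidedExpansive η v

end PlaneColoring

open PlaneColoring

open PlaneColoring

/-! Choose unimodular coordinates in which the direction is vertical, and suppose the opposite
direction is expansive: then finitely many consecutive columns determine the column on their left,
for all points of the orbit closure. If the direction itself were nonexpansive, compactness would
give `f` and `g` in the orbit closure that agree on the half plane `x 0 ≤ 0` but not on the column
`x 0 = 1`.

The complexity bound makes such ambiguity periodic. In the parallelogram corresponding to the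
rectangle, the columns from the center rightwards contain at least half of the points, so one of
them adds fewer colorings than points (`exists_strip_period`). It contains a segment of `N + 1`
points with generated endpoints that adds at most `N` colorings. Hence at most `N` colorings to its
left extend ambiguously, while by central symmetry each column there has `N` consecutive points.
Morse–Hedlund then gives a vertical period (`exists_period_of_nonunique`).

Comparing `f` with its own vertical translate spreads this period to the whole plane; likewise for
`g`. Strips of fixed width now take finitely many values, so by determinism `f` and `g` have a
common horizontal period on a half plane containing `x 0 ≤ 1`. It carries their agreement from `x 0
≤ 0` to the column `x 0 = 1`, a contradiction (`right_deterministic_of_left_deterministic`).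

For the edges, consider the face of a generating set that is extreme on the right of the direction.
Were it a single vertex, generation of this vertex would make the direction expansive. -/

namespace PlaneColoring

/-! ### Orbit closure and unique extension. -/

variable {A : Type*}

/-- The orbit closure of `η`: the configurations all of whose finite patterns occur in `η`. -/
def orbitClosure (η : (Fin 2 → ℤ) → A) : Set ((Fin 2 → ℤ) → A) :=
  {f | ∀ F : Set (Fin 2 → ℤ), F.Finite → ∃ u, ∀ x ∈ F, f x = η (x + u)}

theorem shift_mem_orbitClosure {η f : (Fin 2 → ℤ) → A} (hf : f ∈ orbitClosure η)
    (u : Fin 2 → ℤ) : shift u f ∈ orbitClosure η := by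
  intro F hF
  obtain ⟨w, hw⟩ := hf ((fun x => x + u) '' F) (hF.image _)
  refine ⟨u + w, fun x hx => ?_⟩
  rw [shift, hw _ ⟨x, hx, rfl⟩, add_assoc]

theorem domRestrict_mem_colorings {η f : (Fin 2 → ℤ) → A} (hf : f ∈ orbitClosure η)
    {S : Set (Fin 2 → ℤ)} (hS : S.Finite) : S.domRestrict f ∈ colorings η S := by
  obtain ⟨u, hu⟩ := hf S hS
  refine ⟨u, ?_⟩
  funext x
  exact (hu x x.2).symm

/-- Existence of an extension is automatic, since a coloring of `T` comes from a translate of `η` on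
the whole plane; only uniqueness carries content. -/
theorem allExtendUniquely_iff (η : (Fin 2 → ℤ) → A) {T S : Set (Fin 2 → ℤ)} (h : T ⊆ S) :
    AllExtendUniquely η h ↔ ∀ u u', (∀ x ∈ T, η (x + u) = η (x + u')) →
      ∀ x ∈ S, η (x + u) = η (x + u') := by
  constructor
  · intro H u u' hT x hx
    obtain ⟨β, -, hβ⟩ := H (T.domRestrict (shift u η)) ⟨u, rfl⟩
    have h1 := hβ (S.domRestrict (shift u η)) ⟨⟨u, rfl⟩, rfl⟩
    have h2 := hβ (S.domRestrict (shift u' η)) ⟨⟨u', rfl⟩, by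
      funext y; exact (hT y y.2).symm⟩
    exact congrFun (h1.trans h2.symm) ⟨x, hx⟩
  · rintro H _ ⟨u, rfl⟩
    refine ⟨S.domRestrict (shift u η), ⟨⟨u, rfl⟩, rfl⟩, ?_⟩
    rintro _ ⟨⟨u', rfl⟩, hu'⟩
    funext x
    exact H u' u (fun y hy => congrFun hu' ⟨y, hy⟩) x x.2

/-- If unique extension holds for the `η`-colorings, it holds for the orbit closure. -/
theorem eq_of_allExtendUniquely {η f g : (Fin 2 → ℤ) → A} {T S : Set (Fin 2 → ℤ)} {h : T ⊆ S}
    (H : AllExtendUniquely η h) (hS : S.Finite) (hf : f ∈ orbitClosure η)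
    (hg : g ∈ orbitClosure η) (hT : ∀ x ∈ T, f x = g x) : ∀ x ∈ S, f x = g x := by
  obtain ⟨u, hu⟩ := hf S hS
  obtain ⟨u', hu'⟩ := hg S hS
  intro x hx
  rw [hu x hx, hu' x hx]
  exact (allExtendUniquely_iff η h).1 H u u'
    (fun y hy => by rw [← hu y (h hy), ← hu' y (h hy), hT y hy]) x hx

theorem image_colorings (η : (Fin 2 → ℤ) → A) {T S : Set (Fin 2 → ℤ)} (h : T ⊆ S) :
    Set.domRestrict₂ (π := fun _ => A) h '' colorings η S = colorings η T := by
  rw [colorings, ← Set.range_comp]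
  rfl

/-! ### Counting colorings, and compactness. -/

section Finite
variable [Finite A]

theorem colorings_finite (η : (Fin 2 → ℤ) → A) {S : Set (Fin 2 → ℤ)} (hS : S.Finite) :
    (colorings η S).Finite := by
  have := hS.to_subtype
  exact Set.toFinite _

theorem complexity_mono (η : (Fin 2 → ℤ) → A) {T S : Set (Fin 2 → ℤ)} (h : T ⊆ S)
    (hS : S.Finite) : complexity η T ≤ complexity η S := by
  rw [complexity, complexity, ← image_colorings η h]
  exact Set.ncard_image_le (colorings_finite η hS)

theorem complexity_pos (η : (Fin 2 → ℤ) → A) {S : Set (Fin 2 → ℤ)} (hS : S.Finite) :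
    0 < complexity η S :=
  (Set.ncard_pos (colorings_finite η hS)).2 ⟨_, 0, rfl⟩

/-- Restriction maps the finite set of colorings of `S` onto that of `T`; a surjection that does not
lower the cardinality is injective. -/
theorem allExtendUniquely_of_complexity_le (η : (Fin 2 → ℤ) → A) {T S : Set (Fin 2 → ℤ)}
    (h : T ⊆ S) (hS : S.Finite) (hle : complexity η S ≤ complexity η T) :
    AllExtendUniquely η h := by
  have hinj : Set.InjOn (Set.domRestrict₂ (π := fun _ => A) h) (colorings η S) := by
    refine Set.injOn_of_ncard_image_eq ?_ (colorings_finite η hS)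
    rw [image_colorings]
    exact le_antisymm (complexity_mono η h hS) hle
  intro α hα
  rw [← image_colorings η h] at hα
  obtain ⟨β, hβ, rfl⟩ := hα
  exact ⟨β, ⟨hβ, rfl⟩, fun γ hγ => hinj hγ.1 hβ hγ.2⟩

/-- The number of colorings of `T` that extend in several ways to `S` is at most
`P(S) - P(T)`. -/
theorem ncard_nonunique_add_le (η : (Fin 2 → ℤ) → A) {T S : Set (Fin 2 → ℤ)} (h : T ⊆ S)
    (hS : S.Finite) :
    {α | ∃ β ∈ colorings η S, ∃ γ ∈ colorings η S, β ≠ γ ∧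
      Set.domRestrict₂ (π := fun _ => A) h β = α ∧
      Set.domRestrict₂ (π := fun _ => A) h γ = α}.ncard + complexity η T ≤ complexity η S := by
  classical
  set r := Set.domRestrict₂ (π := fun _ => A) h with hr
  set Q := {α | ∃ β ∈ colorings η S, ∃ γ ∈ colorings η S, β ≠ γ ∧ r β = α ∧ r γ = α} with hQ
  have hsec : ∀ α : colorings η T, ∃ β ∈ colorings η S, r β = α := by
    rintro ⟨α, hα⟩
    rw [← image_colorings η h] at hα
    exact hα
  choose s hs hsr using hsec
  have hsinj : Function.Injective s := fun a b hab =>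
    Subtype.ext (by rw [← hsr a, ← hsr b, hab])
  -- The section `s` selects one extension of each coloring of `T`; a coloring with two extensions
  -- has one that is not selected.
  have hsub : Q ⊆ r '' (colorings η S \ Set.range s) := by
    rintro α ⟨β, hβ, γ, hγ, hne, rfl, hγα⟩
    by_cases hβs : β ∈ Set.range s
    · refine ⟨γ, ⟨hγ, ?_⟩, hγα⟩
      rintro ⟨b, rfl⟩
      obtain ⟨a, rfl⟩ := hβs
      rw [hsr, hsr] at hγα
      exact hne (congrArg s (Subtype.ext hγα)).symm
    · exact ⟨β, ⟨hβ, hβs⟩, rfl⟩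
  have hfin := colorings_finite η hS
  have h1 : Q.ncard ≤ (colorings η S \ Set.range s).ncard :=
    (Set.ncard_le_ncard hsub ((hfin.subset Set.sdiff_subset).image _)).trans
      (Set.ncard_image_le (hfin.subset Set.sdiff_subset))
  have h2 : (Set.range s).ncard = complexity η T := by
    rw [← Set.image_univ, Set.ncard_image_of_injective _ hsinj, Set.ncard_univ]
    rfl
  have h3 := Set.ncard_sdiff_add_ncard_of_subset
    (show Set.range s ⊆ colorings η S by rintro _ ⟨a, rfl⟩; exact hs a) hfin
  rw [h2] at h3
  refine le_of_le_of_eq ?_ h3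
  exact Nat.add_le_add_right h1 _

/-- Compactness: nonunique extensions from larger and larger sets yield two points of the orbit
closure that agree on the union of these sets. -/
theorem exists_mem_orbitClosure (η : (Fin 2 → ℤ) → A) (B : ℕ → Set (Fin 2 → ℤ)) (z : Fin 2 → ℤ)
    (H : ∀ n, ∃ u u', (∀ x ∈ B n, η (x + u) = η (x + u')) ∧ η (z + u) ≠ η (z + u')) :
    ∃ f ∈ orbitClosure η, ∃ g ∈ orbitClosure η,
      (∀ x, (∀ᶠ n in Filter.atTop, x ∈ B n) → f x = g x) ∧ f z ≠ g z := by
  choose u u' hB hz using H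
  let U : Ultrafilter ℕ := Filter.hyperfilter ℕ
  have hU : (U : Filter ℕ) ≤ Filter.atTop := by
    have := Filter.hyperfilter_le_cofinite (α := ℕ)
    rwa [Nat.cofinite_eq_atTop] at this
  -- As `A` is finite, each sequence in `A` is constant along the ultrafilter, which replaces
  -- extraction of convergent subsequences.
  have key : ∀ s : ℕ → A, ∃ a, ∀ᶠ n in U, s n = a := fun s =>
    Ultrafilter.eventually_exists_iff.1 (Filter.Eventually.of_forall fun n => ⟨s n, rfl⟩)
  choose lim hlim using key
  have hcl : ∀ w : ℕ → (Fin 2 → ℤ), (fun x => lim fun n => η (x + w n)) ∈ orbitClosure η := by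
    intro w F hF
    obtain ⟨n, hn⟩ := ((Filter.eventually_all_finite hF).2
      fun x _ => hlim fun n => η (x + w n)).exists
    exact ⟨w n, fun x hx => (hn x hx).symm⟩
  refine ⟨_, hcl u, _, hcl u', fun x hx => ?_, fun he => ?_⟩
  · obtain ⟨n, ⟨h1, h2⟩, h3⟩ := (((hlim fun n => η (x + u n)).and
      (hlim fun n => η (x + u' n))).and (hU hx)).exists
    rw [← h1, ← h2]
    exact hB n x h3
  · obtain ⟨n, h1, h2⟩ := ((hlim fun n => η (z + u n)).and (hlim fun n => η (z + u' n))).exists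
    exact hz n (h1.trans (he.trans h2.symm))

end Finite

/-! ### Periodicity of sequences of low complexity. -/

/-- **Morse–Hedlund**: a two-sided sequence with at most `N` words of length `N` has a period
between `1` and `N`. -/
theorem exists_period_of_ncard_words_le {V : Type*} (u : ℤ → V) (N : ℕ)
    (hfin : (Set.range fun (i : ℤ) (k : Fin N) => u (i + k)).Finite)
    (hN : (Set.range fun (i : ℤ) (k : Fin N) => u (i + k)).ncard ≤ N) :
    ∃ q : ℕ, 0 < q ∧ q ≤ N ∧ ∀ i, u (i + q) = u i := by
  let w : (m : ℕ) → ℤ → Fin m → V := fun m i k => u (i + k)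
  have himg : ∀ m, (fun α : Fin (m + 1) → V => Fin.init α) '' Set.range (w (m + 1)) =
      Set.range (w m) := by
    intro m
    rw [← Set.range_comp]
    rfl
  have himg' : ∀ m, (fun α : Fin (m + 1) → V => Fin.tail α) '' Set.range (w (m + 1)) =
      Set.range (w m) := by
    intro m
    rw [← Set.range_comp]
    have : (fun α : Fin (m + 1) → V => Fin.tail α) ∘ w (m + 1) = w m ∘ fun i => i + 1 := by
      funext i k
      simp [w, Fin.tail, add_comm, add_left_comm]
    rw [this, (add_right_surjective (1 : ℤ)).range_comp]
  have hfin' : ∀ m, m ≤ N → (Set.range (w m)).Finite := fun m hm =>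
    Nat.decreasingInduction (motive := fun m _ => (Set.range (w m)).Finite)
      (fun k _ ih => by rw [← himg]; exact ih.image _) hfin hm
  -- Otherwise the number of words would grow at each of `N` steps from the single empty word,
  -- giving `N + 1` words of length `N`.
  obtain ⟨m, hm, hle⟩ : ∃ m < N, (Set.range (w (m + 1))).ncard ≤ (Set.range (w m)).ncard := by
    by_contra! hcon
    have : ∀ m, m ≤ N → m + 1 ≤ (Set.range (w m)).ncard := by
      intro m
      induction m with
      | zero =>
        intro h0
        exact (Set.ncard_pos (hfin' 0 h0)).2 ⟨_, 0, rfl⟩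
      | succ m ih =>
        intro h
        have := ih (by lia)
        have := hcon m (by lia)
        lia
    have := this N le_rfl
    lia
  -- Equal counts in lengths `m` and `m + 1`: a word of length `m` determines its neighbor on the
  -- right (`hinit`) and on the left (`htail`).
  have hinit : Set.InjOn (fun α : Fin (m + 1) → V => Fin.init α) (Set.range (w (m + 1))) :=
    Set.injOn_of_ncard_image_eq (le_antisymm (Set.ncard_image_le (hfin' _ hm))
      (by rwa [himg])) (hfin' _ hm)
  have htail : Set.InjOn (fun α : Fin (m + 1) → V => Fin.tail α) (Set.range (w (m + 1))) :=
    Set.injOn_of_ncard_image_eq (le_antisymm (Set.ncard_image_le (hfin' _ hm))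
      (by rwa [himg'])) (hfin' _ hm)
  have hm1 : ∀ k, k ≤ N → (Set.range (w k)).ncard ≤ N := fun k hk =>
    Nat.decreasingInduction (motive := fun m _ => (Set.range (w m)).ncard ≤ N)
      (fun k hk ih => by
        rw [← himg]; exact (Set.ncard_image_le (hfin' _ hk)).trans ih) hN hk
  have step : ∀ i j, w m i = w m j → w (m + 1) i = w (m + 1) j := fun i j h =>
    hinit ⟨i, rfl⟩ ⟨j, rfl⟩ h
  have hback : ∀ i j, w m (i + 1) = w m (j + 1) → w (m + 1) i = w (m + 1) j := fun i j h =>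
    htail ⟨i, rfl⟩ ⟨j, rfl⟩ (by
      funext k
      have := congrFun h k
      simpa [w, Fin.tail, add_comm, add_left_comm] using this)
  have hshift : ∀ i j, w (m + 1) i = w (m + 1) j → w m (i + 1) = w m (j + 1) := by
    intro i j h
    funext k
    have := congrFun h k.succ
    simpa [w, add_comm, add_left_comm] using this
  have hrestr : ∀ i j, w (m + 1) i = w (m + 1) j → w m i = w m j := fun i j h =>
    congrArg (fun α : Fin (m + 1) → V => Fin.init α) h
  -- There are `N + 1` starting positions and at most `N` words; a coincidence propagates in both
  -- directions.
  obtain ⟨a, ha, b, hb, hab, heq⟩ : ∃ a ∈ Finset.range (N + 1), ∃ b ∈ Finset.range (N + 1),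
      a ≠ b ∧ w m a = w m b := by
    have hmap : ∀ a ∈ Finset.range (N + 1), w m (a : ℕ) ∈ (hfin' m hm.le).toFinset := by
      intro a _
      simp
    refine Finset.exists_ne_map_eq_of_card_lt_of_maps_to ?_ hmap
    rw [← Set.ncard_eq_toFinset_card _ (hfin' m hm.le), Finset.card_range]
    have := hm1 m hm.le
    lia
  wlog hlt : a < b generalizing a b
  · exact this b hb a ha hab.symm heq.symm (by lia)
  rw [Finset.mem_range] at ha hb
  refine ⟨b - a, by lia, by lia, ?_⟩
  have hall : ∀ i : ℤ, w m (a + i) = w m (b + i) := by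
    intro i
    induction i with
    | zero => simpa using heq
    | succ i ih => simpa [add_assoc] using hshift _ _ (step _ _ ih)
    | pred i ih =>
      refine hrestr _ _ (hback _ _ ?_)
      convert ih using 2 <;> ring
  intro i
  have h := congrFun (step _ _ (hall (i - a))) 0
  simp only [w, Fin.val_zero, Nat.cast_zero, add_zero] at h
  rw [show (a : ℤ) + (i - a) = i by ring] at h
  rw [h]
  congr 1
  push_cast [Nat.cast_sub hlt.le]
  ring

/-! ### Columns: vertical determinism and vertical periods. -/

/-- `n` consecutive points of the column `x 0 = t`, the lowest one at height `a`. -/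
def column (t a : ℤ) (n : ℕ) : Set (Fin 2 → ℤ) := {x | x 0 = t ∧ a ≤ x 1 ∧ x 1 < a + n}

theorem column_eq_image (t a : ℤ) (n : ℕ) :
    column t a n = (fun y : ℤ => ![t, y]) '' Set.Ico a (a + n) := by
  ext x
  constructor
  · rintro ⟨rfl, h⟩
    exact ⟨x 1, h, by funext i; fin_cases i <;> rfl⟩
  · rintro ⟨y, hy, rfl⟩
    exact ⟨rfl, hy⟩

theorem column_finite (t a : ℤ) (n : ℕ) : (column t a n).Finite := by
  rw [column_eq_image]
  exact (Set.finite_Ico _ _).image _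

theorem vertical_period_mul {f : (Fin 2 → ℤ) → A} {I : Set ℤ} {d : ℤ}
    (h : ∀ x : Fin 2 → ℤ, x 0 ∈ I → f (x + ![0, d]) = f x) (m : ℤ) :
    ∀ x : Fin 2 → ℤ, x 0 ∈ I → f (x + ![0, d * m]) = f x := by
  have hadd : ∀ (x : Fin 2 → ℤ) (k : ℤ),
      x + ![0, d * (k + 1)] = x + ![0, d * k] + ![0, d] := by
    intro x k
    funext i
    fin_cases i <;> simp [Matrix.vecHead, Matrix.vecTail]
    ring
  induction m with
  | zero =>
    intro x _
    congr 1
    funext i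
    fin_cases i <;> simp
  | succ m ih =>
    intro x hx
    rw [hadd, h _ (by simpa using hx), ih x hx]
  | pred m ih =>
    intro x hx
    rw [← h _ (by simpa using hx), ← hadd, sub_add_cancel, ih x hx]

/-- Two points of the orbit closure that agree on a vertical strip and on a segment of an adjacent
column with generated endpoints agree on the whole column. -/
theorem eq_on_column_of_eq_on_segment {η : (Fin 2 → ℤ) → A} {S₀ : Set (Fin 2 → ℤ)}
    (hfin : S₀.Finite) {t₀ t₁ a : ℤ} {N : ℕ} (hS₀ : ∀ x ∈ S₀, t₀ ≤ x 0 ∧ x 0 < t₁)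
    (hlow : ∀ h : S₀ ∪ column t₁ (a + 1) N ⊆ S₀ ∪ column t₁ a (N + 1), AllExtendUniquely η h)
    (hup : ∀ h : S₀ ∪ column t₁ a N ⊆ S₀ ∪ column t₁ a (N + 1), AllExtendUniquely η h)
    {f g : (Fin 2 → ℤ) → A} (hf : f ∈ orbitClosure η) (hg : g ∈ orbitClosure η)
    (hstrip : ∀ x : Fin 2 → ℤ, t₀ ≤ x 0 → x 0 < t₁ → f x = g x) {i : ℤ}
    (hi : ∀ x ∈ column t₁ (a + i) (N + 1), f x = g x) :
    ∀ x : Fin 2 → ℤ, x 0 = t₁ → f x = g x := by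
  have hSfin : (S₀ ∪ column t₁ a (N + 1)).Finite := hfin.union (column_finite _ _ _)
  have hstep : ∀ j : ℤ, (∀ x ∈ column t₁ (a + j) (N + 1), f x = g x) →
      ∀ x ∈ column t₁ (a + (j + 1)) (N + 1), f x = g x := by
    intro j hj x hx
    -- The first `N` points of the raised segment lie in the previous one; the only new point is its
    -- generated upper endpoint.
    have hT : ∀ z ∈ S₀ ∪ column t₁ a N,
        shift ![0, j + 1] f z = shift ![0, j + 1] g z := by
      rintro z (hz | hz)
      · exact hstrip _ (by simpa using (hS₀ z hz).1) (by simpa using (hS₀ z hz).2)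
      · refine hj _ ?_
        simp only [column, Set.mem_ofPred_eq, Pi.add_apply] at hz ⊢
        simp
        lia
    have := eq_of_allExtendUniquely
      (hup (Set.union_subset_union_right _ fun z hz => by
        simp only [column, Set.mem_ofPred_eq] at hz ⊢
        push_cast
        lia)) hSfin (shift_mem_orbitClosure hf _)
      (shift_mem_orbitClosure hg _) hT (x - ![0, j + 1]) (Or.inr (by
        simp only [column, Set.mem_ofPred_eq, Pi.sub_apply] at hx ⊢
        simp at hx ⊢
        lia))
    simpa only [shift, sub_add_cancel] using this
  have hstep' : ∀ j : ℤ, (∀ x ∈ column t₁ (a + j) (N + 1), f x = g x) →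
      ∀ x ∈ column t₁ (a + (j - 1)) (N + 1), f x = g x := by
    intro j hj x hx
    have hT : ∀ z ∈ S₀ ∪ column t₁ (a + 1) N,
        shift ![0, j - 1] f z = shift ![0, j - 1] g z := by
      rintro z (hz | hz)
      · exact hstrip _ (by simpa using (hS₀ z hz).1) (by simpa using (hS₀ z hz).2)
      · refine hj _ ?_
        simp only [column, Set.mem_ofPred_eq, Pi.add_apply] at hz ⊢
        simp
        lia
    have := eq_of_allExtendUniquely
      (hlow (Set.union_subset_union_right _ fun z hz => by
        simp only [column, Set.mem_ofPred_eq] at hz ⊢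
        push_cast
        lia)) hSfin (shift_mem_orbitClosure hf _)
      (shift_mem_orbitClosure hg _) hT (x - ![0, j - 1]) (Or.inr (by
        simp only [column, Set.mem_ofPred_eq, Pi.sub_apply] at hx ⊢
        simp at hx ⊢
        lia))
    simpa only [shift, sub_add_cancel] using this
  have hall : ∀ j : ℤ, ∀ x ∈ column t₁ (a + (i + j)) (N + 1), f x = g x := by
    intro j
    induction j with
    | zero => simpa using hi
    | succ j ih =>
      have := hstep _ ih
      rwa [add_assoc i] at this
    | pred j ih =>
      have := hstep' _ ih
      rwa [show i + -(j : ℤ) - 1 = i + (-j - 1) by ring] at this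
  intro x hx
  refine hall (x 1 - a - i) x ⟨hx, ?_, ?_⟩
  · lia
  · push_cast
    lia

/-- Let `S` be the union of a set `S₀` in the strip `t₀ ≤ x 0 < t₁`, all of whose columns have `N`
consecutive points, and of a segment of `N + 1` points of the column `x 0 = t₁`.  If the endpoints
of this segment are generated and `P(S) ≤ P(S₀) + N`, then points of the orbit closure whose
restriction to the strip extends in several ways to the next column are periodic on the strip and
on this column. -/
theorem exists_period_of_nonunique [Finite A] {η : (Fin 2 → ℤ) → A} {S₀ : Set (Fin 2 → ℤ)}
    (hfin : S₀.Finite) {t₀ t₁ a : ℤ} {N : ℕ} {y : ℤ → ℤ}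
    (hS₀ : ∀ x ∈ S₀, t₀ ≤ x 0 ∧ x 0 < t₁)
    (hy : ∀ t, t₀ ≤ t → t < t₁ → column t (y t) N ⊆ S₀)
    (hP : complexity η (S₀ ∪ column t₁ a (N + 1)) ≤ complexity η S₀ + N)
    (hlow : ∀ h : S₀ ∪ column t₁ (a + 1) N ⊆ S₀ ∪ column t₁ a (N + 1), AllExtendUniquely η h)
    (hup : ∀ h : S₀ ∪ column t₁ a N ⊆ S₀ ∪ column t₁ a (N + 1), AllExtendUniquely η h) :
    ∃ p : ℕ, 0 < p ∧ ∀ f ∈ orbitClosure η, ∀ g ∈ orbitClosure η,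
      (∀ x : Fin 2 → ℤ, t₀ ≤ x 0 → x 0 < t₁ → f x = g x) →
      (∃ x : Fin 2 → ℤ, x 0 = t₁ ∧ f x ≠ g x) →
      ∀ x : Fin 2 → ℤ, t₀ ≤ x 0 → x 0 ≤ t₁ → f (x + ![0, (p : ℤ)]) = f x := by
  classical
  set S := S₀ ∪ column t₁ a (N + 1) with hS
  have hSfin : S.Finite := hfin.union (column_finite _ _ _)
  have hsub : S₀ ⊆ S := Set.subset_union_left
  set K := complexity η S with hK
  -- The period found below is `q * (c - b)` with `q ≤ N` and `c - b ≤ K`, depending on `f`; this is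
  -- a common multiple.
  refine ⟨N.factorial * K.factorial, by positivity, ?_⟩
  rintro f hf g hg hstrip ⟨z, hz, hne⟩
  set Q := {α | ∃ β ∈ colorings η S, ∃ γ ∈ colorings η S, β ≠ γ ∧
      Set.domRestrict₂ (π := fun _ => A) hsub β = α ∧
      Set.domRestrict₂ (π := fun _ => A) hsub γ = α} with hQ
  have hQN : Q.ncard ≤ N := by
    have := ncard_nonunique_add_le η hsub hSfin
    rw [← hQ] at this
    lia
  have hQfin : Q.Finite := by
    have := hfin.to_subtype
    exact Set.toFinite _
  -- If a vertical translate had equal extensions from `f` and `g`, they would agree on a segment of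
  -- `N + 1` points, hence on the whole column.
  have hmem : ∀ i : ℤ, S₀.domRestrict (shift ![0, i] f) ∈ Q := by
    intro i
    refine ⟨_, domRestrict_mem_colorings (shift_mem_orbitClosure hf ![0, i]) hSfin,
      _, domRestrict_mem_colorings (shift_mem_orbitClosure hg ![0, i]) hSfin, ?_, rfl, ?_⟩
    · intro heq
      refine hne (eq_on_column_of_eq_on_segment hfin hS₀ hlow hup hf hg hstrip (i := i)
        (fun x hx => ?_) z hz)
      have hxS : x - ![0, i] ∈ S := Or.inr (by
        simp only [column, Set.mem_ofPred_eq, Pi.sub_apply] at hx ⊢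
        simp at hx ⊢
        lia)
      simpa only [shift, sub_add_cancel, Set.domRestrict_apply] using congrFun heq ⟨_, hxS⟩
    · funext x
      exact (hstrip _ (by simpa using (hS₀ x x.2).1) (by simpa using (hS₀ x x.2).2)).symm
  let u : ℤ → Set.Ico t₀ t₁ → A := fun i t => f ![t, y t + i]
  have hcol : ∀ (k : Fin N) (t : Set.Ico t₀ t₁), ![(t : ℤ), y t + k] ∈ S₀ := fun k t =>
    hy t t.2.1 t.2.2 ⟨rfl, by simp, by simp⟩
  have hwords : (Set.range fun (i : ℤ) (k : Fin N) => u (i + k)) ⊆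
      (fun (α : S₀ → A) (k : Fin N) (t : Set.Ico t₀ t₁) => α ⟨_, hcol k t⟩) '' Q := by
    rintro _ ⟨i, rfl⟩
    refine ⟨_, hmem i, ?_⟩
    funext k t
    simp only [u, shift, Set.domRestrict_apply]
    congr 1
    funext j
    fin_cases j <;> simp
    ring
  obtain ⟨q, hq0, hqN, hq⟩ := exists_period_of_ncard_words_le u N
    ((hQfin.image _).subset hwords)
    ((Set.ncard_le_ncard hwords (hQfin.image _)).trans ((Set.ncard_image_le hQfin).trans hQN))
  have hper : ∀ x : Fin 2 → ℤ, x 0 ∈ Set.Ico t₀ t₁ → f (x + ![0, (q : ℤ)]) = f x := by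
    intro x hx
    have := congrFun (hq (x 1 - y (x 0))) ⟨x 0, hx⟩
    simp only [u] at this
    convert this using 2
    · funext j
      fin_cases j <;> simp
      ring
    · funext j
      fin_cases j <;> simp
  -- Translates by multiples of `q` agree on the strip. Two of `K + 1` of them also agree on the
  -- segment, hence on the whole column `x 0 = t₁`.
  obtain ⟨b, hb, c, hc, hbc, heq⟩ : ∃ b ∈ Finset.range (K + 1), ∃ c ∈ Finset.range (K + 1),
      b ≠ c ∧ S.domRestrict (shift ![0, (q : ℤ) * b] f) =
        S.domRestrict (shift ![0, (q : ℤ) * c] f) := by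
    have hcfin := colorings_finite η hSfin
    refine Finset.exists_ne_map_eq_of_card_lt_of_maps_to (t := hcfin.toFinset)
      (f := fun b : ℕ => S.domRestrict (shift ![0, (q : ℤ) * b] f)) ?_ ?_
    · rw [← Set.ncard_eq_toFinset_card _ hcfin, Finset.card_range]
      exact Nat.lt_succ_self _
    · intro b _
      simp only [Set.Finite.coe_toFinset]
      exact domRestrict_mem_colorings (shift_mem_orbitClosure hf _) hSfin
  wlog hlt : b < c generalizing b c
  · exact this c hc b hb hbc.symm heq.symm (by lia)
  rw [Finset.mem_range] at hb hc
  have hshift : ∀ x : Fin 2 → ℤ, x 0 = t₁ →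
      shift ![0, (q : ℤ) * b] f x = shift ![0, (q : ℤ) * c] f x := by
    refine eq_on_column_of_eq_on_segment hfin hS₀ hlow hup (shift_mem_orbitClosure hf _)
      (shift_mem_orbitClosure hf _) (fun x h0 h1 => ?_) (i := 0) (fun x hx => ?_)
    · simp only [shift]
      rw [vertical_period_mul hper b x ⟨h0, h1⟩, vertical_period_mul hper c x ⟨h0, h1⟩]
    · exact congrFun heq ⟨x, Or.inr (by simpa using hx)⟩
  have hper' : ∀ x : Fin 2 → ℤ, x 0 ∈ Set.Icc t₀ t₁ →
      f (x + ![0, (q : ℤ) * (c - b : ℕ)]) = f x := by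
    intro x hx
    rcases hx.2.lt_or_eq with h | h
    · exact vertical_period_mul hper _ x ⟨hx.1, h⟩
    · have := hshift (x - ![0, (q : ℤ) * b]) (by simpa using h)
      simp only [shift, sub_add_cancel] at this
      rw [this]
      congr 1
      funext j
      fin_cases j <;> simp [Nat.cast_sub hlt.le, Matrix.vecHead, Matrix.vecTail]
      ring
  obtain ⟨m, hm⟩ : q * (c - b) ∣ N.factorial * K.factorial :=
    mul_dvd_mul (Nat.dvd_factorial hq0 hqN) (Nat.dvd_factorial (by lia) (by lia))
  intro x h0 h1
  have := vertical_period_mul hper' m x ⟨h0, h1⟩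
  rw [hm]
  exact_mod_cast this

/-! ### From determinism on the left to determinism on the right. -/

/-- If `a + 1` consecutive columns determine the column on their left, they determine everything on
their left. -/
theorem eq_of_left_deterministic {η : (Fin 2 → ℤ) → A} {a : ℕ}
    (hleft : ∀ f ∈ orbitClosure η, ∀ g ∈ orbitClosure η,
      (∀ x : Fin 2 → ℤ, 0 ≤ x 0 → x 0 ≤ a → f x = g x) → ∀ x : Fin 2 → ℤ, x 0 = -1 → f x = g x)
    {f g : (Fin 2 → ℤ) → A} (hf : f ∈ orbitClosure η) (hg : g ∈ orbitClosure η) {s : ℤ}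
    (h : ∀ x : Fin 2 → ℤ, s ≤ x 0 → x 0 ≤ s + a → f x = g x) :
    ∀ x : Fin 2 → ℤ, x 0 ≤ s + a → f x = g x := by
  have key : ∀ n : ℕ, ∀ x : Fin 2 → ℤ, s - n ≤ x 0 → x 0 ≤ s + a → f x = g x := by
    intro n
    induction n with
    | zero => simpa using h
    | succ n ih =>
      intro x h0 h1
      by_cases hx : s - n ≤ x 0
      · exact ih x hx h1
      have := hleft _ (shift_mem_orbitClosure hf ![s - n, 0]) _
        (shift_mem_orbitClosure hg ![s - n, 0])
        (fun z hz0 hz1 => ih _ (by simpa using hz0) (by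
          simp only [Pi.add_apply, Matrix.cons_val_zero]
          lia)) (x - ![s - n, 0]) (by
          simp only [Pi.sub_apply, Matrix.cons_val_zero]
          push_cast at h0
          lia)
      simpa only [shift, sub_add_cancel] using this
  intro x hx
  exact key (s - x 0).toNat x (by lia) hx

/-- If columns are determined by the columns on their right, and configurations whose restriction
to a strip extends in several ways to the right are periodic there, then the restriction to a left
half plane determines the whole configuration. -/
theorem right_deterministic_of_left_deterministic [Finite A] {η : (Fin 2 → ℤ) → A} {a : ℕ}
    (hleft : ∀ f ∈ orbitClosure η, ∀ g ∈ orbitClosure η,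
      (∀ x : Fin 2 → ℤ, 0 ≤ x 0 → x 0 ≤ a → f x = g x) → ∀ x : Fin 2 → ℤ, x 0 = -1 → f x = g x)
    {t₀ t₁ : ℤ} (ht : t₀ ≤ t₁) {p : ℕ} (hp : 0 < p)
    (hper : ∀ f ∈ orbitClosure η, ∀ g ∈ orbitClosure η,
      (∀ x : Fin 2 → ℤ, t₀ ≤ x 0 → x 0 < t₁ → f x = g x) →
      (∃ x : Fin 2 → ℤ, x 0 = t₁ ∧ f x ≠ g x) →
      ∀ x : Fin 2 → ℤ, t₀ ≤ x 0 → x 0 ≤ t₁ → f (x + ![0, (p : ℤ)]) = f x)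
    {f g : (Fin 2 → ℤ) → A} (hf : f ∈ orbitClosure η) (hg : g ∈ orbitClosure η)
    (h : ∀ x : Fin 2 → ℤ, x 0 ≤ 0 → f x = g x) :
    ∀ x : Fin 2 → ℤ, x 0 = 1 → f x = g x := by
  have hper' : ∀ s : ℤ, ∀ f ∈ orbitClosure η, ∀ g ∈ orbitClosure η,
      (∀ x : Fin 2 → ℤ, s - (t₁ - t₀) ≤ x 0 → x 0 < s → f x = g x) →
      (∃ x : Fin 2 → ℤ, x 0 = s ∧ f x ≠ g x) →
      ∀ x : Fin 2 → ℤ, s - (t₁ - t₀) ≤ x 0 → x 0 ≤ s → f (x + ![0, (p : ℤ)]) = f x := by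
    rintro s f hf g hg hfg ⟨z, hz, hne⟩ x h0 h1
    have := hper _ (shift_mem_orbitClosure hf ![s - t₁, 0]) _
      (shift_mem_orbitClosure hg ![s - t₁, 0])
      (fun w hw0 hw1 => hfg _
        (by simp only [Pi.add_apply, Matrix.cons_val_zero]; lia)
        (by simp only [Pi.add_apply, Matrix.cons_val_zero]; lia))
      ⟨z - ![s - t₁, 0], by simp [hz], by simpa only [shift, sub_add_cancel] using hne⟩
      (x - ![s - t₁, 0]) (by simp only [Pi.sub_apply, Matrix.cons_val_zero]; lia)
      (by simp only [Pi.sub_apply, Matrix.cons_val_zero]; lia)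
    simpa only [shift, sub_add_cancel, sub_add_eq_add_sub, add_sub_cancel_right,
      add_right_comm _ ![0, (p : ℤ)]] using this
  by_contra! hcon
  have hall : ∀ f ∈ orbitClosure η, ∀ g ∈ orbitClosure η,
      (∀ x : Fin 2 → ℤ, x 0 ≤ 0 → f x = g x) → (∃ x : Fin 2 → ℤ, x 0 = 1 ∧ f x ≠ g x) →
      ∀ x : Fin 2 → ℤ, f (x + ![0, (p : ℤ)]) = f x := by
    intro f hf g hg h hne
    have hpf := shift_mem_orbitClosure hf ![0, (p : ℤ)]
    have key : ∀ n : ℕ, ∀ x : Fin 2 → ℤ, 1 - (t₁ - t₀) ≤ x 0 → x 0 ≤ 1 + n →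
        f (x + ![0, (p : ℤ)]) = f x := by
      intro n
      induction n with
      | zero =>
        simpa using hper' 1 f hf g hg (fun x _ hx => h x (by lia)) hne
      | succ n ih =>
        intro x h0 h1
        by_cases hx : x 0 ≤ 1 + n
        · exact ih x h0 hx
        -- The pair consists of `f` and its vertical translate, which agree on the preceding
        -- columns: if they differ on this one, `hper'` yields the period anyway.
        by_cases heq : f x = f (x + ![0, (p : ℤ)])
        · exact heq.symm
        push_cast at h1
        exact hper' (2 + n) f hf _ hpf
          (fun x h2 h3 => (ih x (by lia) (by lia)).symm) ⟨x, by lia, heq⟩ x (by lia) (by lia)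
    intro x
    rcases le_total (x 0) 1 with hx | hx
    · exact eq_of_left_deterministic hleft hpf hf (s := 1)
        (fun z hz0 hz1 => key a z (by lia) hz1) x (by lia)
    · exact key (x 0 - 1).toNat x (by lia) (by lia)
  have hfp := hall f hf g hg h hcon
  have hgp := hall g hg f hf (fun x hx => (h x hx).symm)
    (by obtain ⟨x, hx, hne⟩ := hcon; exact ⟨x, hx, hne.symm⟩)
  -- For a vertically `p`-periodic configuration this finite block encodes the `a + 1` columns
  -- starting at `j`, which determine everything on their left.
  let st : ((Fin 2 → ℤ) → A) → ℕ → Fin (a + 1) → Fin p → A :=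
    fun f j i k => f ![(j : ℤ) + i, k]
  have hst : ∀ f ∈ orbitClosure η, (∀ x : Fin 2 → ℤ, f (x + ![0, (p : ℤ)]) = f x) →
      ∀ j₁ j₂ : ℕ, st f j₁ = st f j₂ → ∀ x : Fin 2 → ℤ, x 0 ≤ j₁ + a →
      f (x + ![(j₂ : ℤ) - j₁, 0]) = f x := by
    intro f hf hfp j₁ j₂ hj
    refine eq_of_left_deterministic hleft (shift_mem_orbitClosure hf _) hf fun x h0 h1 => ?_
    have hred : ∀ z : Fin 2 → ℤ, f z = f ![z 0, z 1 % p] := by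
      intro z
      rw [← vertical_period_mul (I := Set.univ) (fun x _ => hfp x) (z 1 / p) ![z 0, z 1 % p] trivial]
      congr 1
      funext i
      fin_cases i
      · simp
      · simp [Int.emod_add_mul_ediv]
    have hm0 := Int.emod_nonneg (x 1) (b := p) (by lia)
    have hm1 := Int.emod_lt_of_pos (x 1) (b := p) (by lia)
    have := congrFun (congrFun hj ⟨(x 0 - j₁).toNat, by lia⟩) ⟨(x 1 % p).toNat, by lia⟩
    simp only [st, Int.toNat_of_nonneg hm0, Int.toNat_of_nonneg (sub_nonneg.2 h0)] at this
    rw [shift, hred, hred x]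
    convert this.symm using 2
    · funext i
      fin_cases i <;> simp
      ring
    · funext i
      fin_cases i <;> simp
  -- Taking the pair gives `f` and `g` the same horizontal period `j₂ - j₁`, and `j₁ ≥ 0` makes it
  -- valid up to the column `x 0 = 1` once reached from the left.
  obtain ⟨j₁, j₂, hne, heq⟩ := Finite.exists_ne_map_eq_of_infinite fun j => (st f j, st g j)
  wlog hlt : j₁ < j₂ generalizing j₁ j₂
  · exact this j₂ j₁ hne.symm heq.symm (by lia)
  rw [Prod.mk.injEq] at heq
  obtain ⟨x, hx, hxne⟩ := hcon
  refine hxne ?_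
  have h1 := hst f hf hfp j₁ j₂ heq.1 (x - ![(j₂ : ℤ) - j₁, 0]) (by
    simp only [Pi.sub_apply, Matrix.cons_val_zero]; lia)
  have h2 := hst g hg hgp j₁ j₂ heq.2 (x - ![(j₂ : ℤ) - j₁, 0]) (by
    simp only [Pi.sub_apply, Matrix.cons_val_zero]; lia)
  rw [sub_add_cancel] at h1 h2
  rw [h1, h2]
  exact h _ (by simp only [Pi.sub_apply, Matrix.cons_val_zero]; lia)

/-! ### Rectangles and their unimodular preimages. -/

theorem mulVec_fin_two (M : Matrix (Fin 2) (Fin 2) ℤ) (x : Fin 2 → ℤ) (i : Fin 2) :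
    (M *ᵥ x) i = M i 0 * x 0 + M i 1 * x 1 := by
  simp [Matrix.mulVec, dotProduct, Fin.sum_univ_two]

theorem rect_eq_image (n k : ℕ) :
    rect n k = (fun p : ℤ × ℤ => ![p.1, p.2]) '' (Set.Ico 0 (n : ℤ) ×ˢ Set.Ico 0 (k : ℤ)) := by
  ext x
  constructor
  · rintro ⟨h0, h1, h2, h3⟩
    exact ⟨(x 0, x 1), ⟨⟨h0, h1⟩, ⟨h2, h3⟩⟩, by funext i; fin_cases i <;> rfl⟩
  · rintro ⟨p, ⟨⟨h0, h1⟩, ⟨h2, h3⟩⟩, rfl⟩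
    exact ⟨h0, h1, h2, h3⟩

theorem rect_finite (n k : ℕ) : (rect n k).Finite := by
  rw [rect_eq_image]
  exact ((Set.finite_Ico _ _).prod (Set.finite_Ico _ _)).image _

theorem ncard_Ico_int (a : ℤ) (n : ℕ) : (Set.Ico a (a + n)).ncard = n := by
  rw [← Finset.coe_Ico, Set.ncard_coe_finset]
  simp

theorem ncard_rect (n k : ℕ) : (rect n k).ncard = n * k := by
  rw [rect_eq_image, Set.ncard_image_of_injective, Set.ncard_prod]
  · have h1 := ncard_Ico_int 0 n
    have h2 := ncard_Ico_int 0 k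
    rw [zero_add] at h1 h2
    rw [h1, h2]
  · intro p q h
    exact Prod.ext (congrFun h 0) (congrFun h 1)

theorem ncard_column (t a : ℤ) (n : ℕ) : (column t a n).ncard = n := by
  rw [column_eq_image, Set.ncard_image_of_injective, ncard_Ico_int]
  intro y z h
  exact congrFun h 1

/-- A finite order-connected set of integers is an interval. -/
theorem exists_eq_Ico_of_ordConnected {C : Set ℤ} (hfin : C.Finite) (hC : C.OrdConnected) :
    ∃ (a : ℤ) (n : ℕ), C = Set.Ico a (a + n) := by
  rcases C.eq_empty_or_nonempty with rfl | hne
  · exact ⟨0, 0, by simp⟩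
  obtain ⟨a, ha, hmin⟩ := hfin.exists_minimal hne
  obtain ⟨b, hb, hmax⟩ := hfin.exists_maximal hne
  have hmin' : ∀ y ∈ C, a ≤ y := fun y hy => (le_total a y).elim id fun h => hmin hy h
  have hmax' : ∀ y ∈ C, y ≤ b := fun y hy => (le_total y b).elim id fun h => hmax hy h
  refine ⟨a, (b - a + 1).toNat, ?_⟩
  have := hmin' b hb
  ext y
  constructor
  · intro hy
    have := hmin' y hy
    have := hmax' y hy
    constructor <;> lia
  · rintro ⟨h0, h1⟩
    exact hC.out ha hb ⟨h0, by lia⟩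

section LinearImage

variable (M : Matrix.SpecialLinearGroup (Fin 2) ℤ) (n k : ℕ)

/-- The lattice parallelogram that `M` maps to the rectangle `rect n k`. -/
def preRect : Set (Fin 2 → ℤ) := {x | M.val *ᵥ x ∈ rect n k}

theorem inv_mulVec_mulVec (x : Fin 2 → ℤ) : (M⁻¹).val *ᵥ (M.val *ᵥ x) = x := by
  rw [Matrix.mulVec_mulVec, ← Matrix.SpecialLinearGroup.coe_mul, inv_mul_cancel,
    Matrix.SpecialLinearGroup.coe_one, Matrix.one_mulVec]

theorem mulVec_inv_mulVec (x : Fin 2 → ℤ) : M.val *ᵥ ((M⁻¹).val *ᵥ x) = x := by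
  simpa using inv_mulVec_mulVec M⁻¹ x

theorem mulVec_special_injective : Function.Injective fun x : Fin 2 → ℤ => M.val *ᵥ x :=
  Function.LeftInverse.injective (inv_mulVec_mulVec M)

theorem preRect_finite : (preRect M n k).Finite :=
  (rect_finite n k).preimage (mulVec_special_injective M).injOn

theorem ncard_preRect : (preRect M n k).ncard = n * k := by
  rw [← ncard_rect, ← Set.ncard_image_of_injective _ (mulVec_special_injective M)]
  congr 1
  ext x
  constructor
  · rintro ⟨y, hy, rfl⟩
    exact hy
  · intro hx
    exact ⟨(M⁻¹).val *ᵥ x, by simpa only [preRect, Set.mem_ofPred_eq, mulVec_inv_mulVec] using hx,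
      mulVec_inv_mulVec M x⟩

/-- The translate of `η ∘ M` by `u` is the translate of `η` by `M u` read through `M`, so every
coloring here is induced by one of the rectangle. -/
theorem complexity_preRect_le [Finite A] (η : (Fin 2 → ℤ) → A) :
    complexity (fun x => η (M.val *ᵥ x)) (preRect M n k) ≤ complexity η (rect n k) := by
  have hfin := colorings_finite η (rect_finite n k)
  have hsub : colorings (fun x => η (M.val *ᵥ x)) (preRect M n k) ⊆
      (fun (α : rect n k → A) (x : preRect M n k) => α ⟨M.val *ᵥ x, x.2⟩) ''
        colorings η (rect n k) := by
    rintro _ ⟨u, rfl⟩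
    refine ⟨_, ⟨M.val *ᵥ u, rfl⟩, ?_⟩
    funext x
    simp only [Set.domRestrict_apply, shift, Matrix.mulVec_add]
  exact (Set.ncard_le_ncard hsub (hfin.image _)).trans (Set.ncard_image_le hfin)

/-- Along a vertical line both coordinates of `M x` are monotone in the height, so the constraints
cut out an interval. -/
theorem exists_column_eq (t : ℤ) :
    ∃ (a : ℤ) (N : ℕ), {x | x ∈ preRect M n k ∧ x 0 = t} = column t a N := by
  obtain ⟨a, N, h⟩ := exists_eq_Ico_of_ordConnected (C := {y : ℤ | ![t, y] ∈ preRect M n k})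
    ((preRect_finite M n k).preimage fun y _ z _ h => congrFun h 1) (by
      refine ⟨fun y hy z hz w hw => ?_⟩
      simp only [preRect, rect, Set.mem_ofPred_eq, mulVec_fin_two, Matrix.cons_val_zero,
        Matrix.cons_val_one] at hy hz ⊢
      have mono : ∀ m : ℤ, (m * y ≤ m * w ∧ m * w ≤ m * z) ∨ (m * z ≤ m * w ∧ m * w ≤ m * y) := by
        intro m
        rcases le_total 0 m with hm | hm
        · exact Or.inl ⟨mul_le_mul_of_nonneg_left hw.1 hm, mul_le_mul_of_nonneg_left hw.2 hm⟩
        · exact Or.inr ⟨mul_le_mul_of_nonpos_left hw.2 hm, mul_le_mul_of_nonpos_left hw.1 hm⟩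
      have h0 := mono (M.val 0 1)
      have h1 := mono (M.val 1 1)
      refine ⟨?_, ?_, ?_, ?_⟩ <;> lia)
  refine ⟨a, N, ?_⟩
  ext x
  have hx : ![x 0, x 1] = x := by funext i; fin_cases i <;> rfl
  constructor
  · rintro ⟨hR, rfl⟩
    exact ⟨rfl, h.subset (by simpa only [Set.mem_ofPred_eq, hx] using hR)⟩
  · rintro ⟨rfl, hy⟩
    exact ⟨by simpa only [Set.mem_ofPred_eq, hx] using h.superset hy, rfl⟩

end LinearImage

/-! ### Central symmetry and the choice of a column. -/

/-- A linear form with values in `[0, B]` on a parallelogram centered at `c / 2`, evaluated at a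
point `(t, y)` of the parallelogram. -/
theorem linear_form_bounds {m₀ m₁ B c₀ c₁ t t' a b y : ℤ} (hc : m₀ * c₀ + m₁ * c₁ = B)
    (ha : 0 ≤ m₀ * t' + m₁ * a ∧ m₀ * t' + m₁ * a ≤ B)
    (hb : 0 ≤ m₀ * t' + m₁ * b ∧ m₀ * t' + m₁ * b ≤ B)
    (ht : c₀ ≤ 2 * t) (htt : t < t')
    (hlo : (t' - t) * (c₁ - b) + (t - c₀ + t') * a ≤ (2 * t' - c₀) * y)
    (hhi : (2 * t' - c₀) * y ≤ (t' - t) * (c₁ - a) + (t - c₀ + t') * b) :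
    0 ≤ m₀ * t + m₁ * y ∧ m₀ * t + m₁ * y ≤ B := by
  -- This is the distance from the column `t'` to its mirror image `c₀ - t'`. The bounds on `y`
  -- interpolate at `t` between the segment `[a, b]` over `t'` and its reflection `[c₁ - b, c₁ -
  -- a]`.
  have hD : 0 < 2 * t' - c₀ := by lia
  have hr : 0 ≤ t' - t := by lia
  have hs : 0 ≤ t - c₀ + t' := by lia
  have ha0 := mul_nonneg hs ha.1
  have ha1 := mul_nonneg hr ha.1
  have hb0 := mul_nonneg hs hb.1
  have hb1 := mul_nonneg hr hb.1
  have ha0' := mul_nonneg hs (sub_nonneg.2 ha.2)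
  have ha1' := mul_nonneg hr (sub_nonneg.2 ha.2)
  have hb0' := mul_nonneg hs (sub_nonneg.2 hb.2)
  have hb1' := mul_nonneg hr (sub_nonneg.2 hb.2)
  subst hc
  rcases le_total 0 m₁ with hm | hm
  · have h1 := mul_nonneg hm (sub_nonneg.2 hlo)
    have h2 := mul_nonneg hm (sub_nonneg.2 hhi)
    constructor
    · refine nonneg_of_mul_nonneg_right (b := m₀ * t + m₁ * y) (a := 2 * t' - c₀) ?_ hD
      linarith
    · refine le_of_mul_le_mul_left (a := 2 * t' - c₀) ?_ hD
      linarith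
  · have h1 := mul_nonneg (neg_nonneg.2 hm) (sub_nonneg.2 hlo)
    have h2 := mul_nonneg (neg_nonneg.2 hm) (sub_nonneg.2 hhi)
    constructor
    · refine nonneg_of_mul_nonneg_right (b := m₀ * t + m₁ * y) (a := 2 * t' - c₀) ?_ hD
      linarith
    · refine le_of_mul_le_mul_left (a := 2 * t' - c₀) ?_ hD
      linarith

/-- In a lattice parallelogram, columns closer to the center have at least as many points, up to
one. -/
theorem exists_column_subset_preRect (M : Matrix.SpecialLinearGroup (Fin 2) ℤ) (n k : ℕ)
    {c : Fin 2 → ℤ} (hc : M.val *ᵥ c = ![(n : ℤ) - 1, (k : ℤ) - 1]) {t t' a : ℤ} {N : ℕ}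
    (ht : c 0 ≤ 2 * t) (htt : t < t') (h : column t' a (N + 1) ⊆ preRect M n k) :
    ∃ y, column t y N ⊆ preRect M n k := by
  have ha : ![t', a] ∈ preRect M n k := h ⟨rfl, le_rfl, by simp⟩
  have hb : ![t', a + N] ∈ preRect M n k := h ⟨rfl, by simp, by simp⟩
  have hc0 := congrFun hc 0
  have hc1 := congrFun hc 1
  simp only [preRect, rect, Set.mem_ofPred_eq, mulVec_fin_two, Matrix.cons_val_zero,
    Matrix.cons_val_one] at ha hb hc0 hc1
  have hD : 0 < 2 * t' - c 0 := by lia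
  set D := 2 * t' - c 0 with hDdef
  set num := (t' - t) * (c 1 - (a + N)) + (t - c 0 + t') * a with hnum
  -- This is the ceiling of `num / D`. The interpolated interval has length `N`, hence contains `N`
  -- consecutive integers from there on.
  refine ⟨-(-num / D), fun x hx => ?_⟩
  obtain ⟨rfl, hx0, hx1⟩ := hx
  have hdiv := Int.emod_add_mul_ediv (-num) D
  have hm0 := Int.emod_nonneg (-num) hD.ne'
  have hm1 := Int.emod_lt_of_pos (-num) hD
  have hlo : num ≤ D * x 1 := by nlinarith
  have hhi : D * x 1 ≤ num + D * N := by nlinarith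
  have hhi' : D * x 1 ≤ (t' - x 0) * (c 1 - a) + (x 0 - c 0 + t') * (a + N) := by
    refine hhi.trans_eq ?_
    rw [hnum, hDdef]
    ring
  have h0 := linear_form_bounds hc0 ⟨ha.1, by lia⟩ ⟨hb.1, by lia⟩ ht htt hlo hhi'
  have h1 := linear_form_bounds hc1 ⟨ha.2.2.1, by lia⟩ ⟨hb.2.2.1, by lia⟩ ht htt hlo hhi'
  simp only [preRect, rect, Set.mem_ofPred_eq, mulVec_fin_two]
  exact ⟨h0.1, by lia, h1.1, by lia⟩

/-- A segment of a column that adds little complexity contains one whose endpoints are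
generated. -/
theorem exists_generated_segment (η : (Fin 2 → ℤ) → A) (S₀ : Set (Fin 2 → ℤ)) (t : ℤ) (n : ℕ) :
    ∀ a, complexity η (S₀ ∪ column t a n) < complexity η S₀ + n →
    ∃ (b : ℤ) (N : ℕ), a ≤ b ∧ b + N + 1 ≤ a + n ∧
      complexity η (S₀ ∪ column t b (N + 1)) ≤ complexity η S₀ + N ∧
      complexity η (S₀ ∪ column t b (N + 1)) ≤ complexity η (S₀ ∪ column t b N) ∧
      complexity η (S₀ ∪ column t b (N + 1)) ≤ complexity η (S₀ ∪ column t (b + 1) N) := by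
  induction n with
  | zero =>
    intro a h
    have : column t a 0 = ∅ := by
      ext x
      simp [column]
    simp [this] at h
  | succ n ih =>
    intro a h
    by_cases h1 : complexity η (S₀ ∪ column t a n) < complexity η S₀ + n
    · obtain ⟨b, N, hb, hN, H⟩ := ih a h1
      exact ⟨b, N, hb, by push_cast; lia, H⟩
    by_cases h2 : complexity η (S₀ ∪ column t (a + 1) n) < complexity η S₀ + n
    · obtain ⟨b, N, hb, hN, H⟩ := ih (a + 1) h2
      exact ⟨b, N, by lia, by push_cast; lia, H⟩
    -- Neither shortening keeps the strict inequality, so each shortened segment already adds at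
    -- least `n` colorings while the full one adds at most `n`: both endpoints are generated.
    exact ⟨a, n, le_rfl, by push_cast; lia, by lia, by lia, by lia⟩

/-- If the complexity of a lattice parallelogram is at most half its cardinality, it contains a
set as in `exists_period_of_nonunique`. -/
theorem exists_strip_period [Finite A] (η : (Fin 2 → ℤ) → A)
    (M : Matrix.SpecialLinearGroup (Fin 2) ℤ) (n k : ℕ)
    (hP : 2 * complexity η (preRect M n k) ≤ n * k) :
    ∃ (t₀ t₁ : ℤ) (p : ℕ), t₀ ≤ t₁ ∧ 0 < p ∧
      ∀ f ∈ orbitClosure η, ∀ g ∈ orbitClosure η,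
      (∀ x : Fin 2 → ℤ, t₀ ≤ x 0 → x 0 < t₁ → f x = g x) →
      (∃ x : Fin 2 → ℤ, x 0 = t₁ ∧ f x ≠ g x) →
      ∀ x : Fin 2 → ℤ, t₀ ≤ x 0 → x 0 ≤ t₁ → f (x + ![0, (p : ℤ)]) = f x := by
  set R := preRect M n k with hR
  have hRfin : R.Finite := preRect_finite M n k
  obtain ⟨c, hc⟩ : ∃ c : Fin 2 → ℤ, M.val *ᵥ c = ![(n : ℤ) - 1, (k : ℤ) - 1] :=
    ⟨_, mulVec_inv_mulVec M _⟩
  -- First column not to the left of the center `c / 2`.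
  set t₀ := (c 0 + 1) / 2 with ht₀
  let U : ℤ → Set (Fin 2 → ℤ) := fun t => {x | x ∈ R ∧ t₀ ≤ x 0 ∧ x 0 < t}
  have hUR : ∀ t, U t ⊆ R := fun t x hx => hx.1
  have hUfin : ∀ t, (U t).Finite := fun t => hRfin.subset (hUR t)
  choose a N hcol using exists_column_eq M n k
  have hcolR : ∀ t, column t (a t) (N t) ⊆ R := fun t x hx => ((hcol t).superset hx).1
  have hUsucc : ∀ t, t₀ ≤ t → U (t + 1) = U t ∪ column t (a t) (N t) := by
    intro t ht
    rw [← hcol]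
    ext x
    simp only [U, Set.mem_union, Set.mem_ofPred_eq, ← hR]
    constructor
    · rintro ⟨h1, h2, h3⟩
      by_cases h : x 0 = t
      · exact Or.inr ⟨h1, h⟩
      · exact Or.inl ⟨h1, h2, by lia⟩
    · rintro (⟨h1, h2, h3⟩ | ⟨h1, h2⟩)
      · exact ⟨h1, h2, by lia⟩
      · exact ⟨h1, by lia, by lia⟩
  have hUcard : ∀ t, t₀ ≤ t → (U (t + 1)).ncard = (U t).ncard + N t := by
    intro t ht
    rw [hUsucc t ht, Set.ncard_union_eq _ (hUfin t) (column_finite _ _ _), ncard_column]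
    rw [Set.disjoint_left]
    intro x hx hx'
    exact hx.2.2.ne hx'.1
  obtain ⟨t, ht, hlt⟩ : ∃ t, t₀ ≤ t ∧
      complexity η (U t ∪ column t (a t) (N t)) < complexity η (U t) + N t := by
    by_contra! hcon
    -- The strict inequality starts from the empty set, which has one coloring and no point.
    have hle : ∀ m : ℕ, (U (t₀ + m)).ncard < complexity η (U (t₀ + m)) := by
      intro m
      induction m with
      | zero =>
        have : U (t₀ + (0 : ℕ)) = ∅ := by
          ext x
          simp [U]
          tauto
        rw [this, Set.ncard_empty]
        exact complexity_pos η Set.finite_empty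
      | succ m ih =>
        have h1 := hcon (t₀ + m) (by lia)
        rw [← hUsucc _ (by lia)] at h1
        have h2 := hUcard (t₀ + m) (by lia)
        push_cast
        rw [← add_assoc]
        lia
    obtain ⟨T, hT⟩ := (hRfin.image fun x => x 0).bddAbove
    have hTU : ∀ x ∈ R, t₀ ≤ x 0 → x ∈ U (t₀ + ((T - t₀).toNat + 1 : ℕ)) := by
      intro x hx h0
      have : x 0 ≤ T := hT ⟨x, hx, rfl⟩
      exact ⟨hx, h0, by push_cast; lia⟩
    -- The right half, center column included, and its reflection cover `R`, so it has at least `n *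
    -- k / 2` points. This is where the factor one half in the bound is used.
    have hcover : R ⊆ U (t₀ + ((T - t₀).toNat + 1 : ℕ)) ∪
        (fun x => c - x) '' U (t₀ + ((T - t₀).toNat + 1 : ℕ)) := by
      intro x hx
      by_cases h0 : t₀ ≤ x 0
      · exact Or.inl (hTU x hx h0)
      · refine Or.inr ⟨c - x, hTU _ ?_ ?_, sub_sub_cancel _ _⟩
        · simp only [hR, preRect, Set.mem_ofPred_eq, Matrix.mulVec_sub, hc] at hx ⊢
          simp only [rect, Set.mem_ofPred_eq, Pi.sub_apply, Matrix.cons_val_zero,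
            Matrix.cons_val_one] at hx ⊢
          lia
        · simp only [Pi.sub_apply]
          lia
    have h1 := Set.ncard_le_ncard hcover ((hUfin _).union ((hUfin _).image _))
    have h2 := Set.ncard_union_le (U (t₀ + ((T - t₀).toNat + 1 : ℕ)))
      ((fun x => c - x) '' U (t₀ + ((T - t₀).toNat + 1 : ℕ)))
    have h3 := Set.ncard_image_le (f := fun x => c - x)
      (hUfin (t₀ + ((T - t₀).toNat + 1 : ℕ)))
    have h4 := hle ((T - t₀).toNat + 1)
    have h5 := complexity_mono η (hUR (t₀ + ((T - t₀).toNat + 1 : ℕ))) hRfin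
    have h6 := ncard_preRect M n k
    rw [← hR] at h6
    lia
  obtain ⟨b, K, hb, hK, h1, h2, h3⟩ := exists_generated_segment η (U t) t (N t) (a t) hlt
  have hseg : column t b (K + 1) ⊆ R := by
    refine Set.Subset.trans ?_ (hcolR t)
    rintro x ⟨hx, hx0, hx1⟩
    push_cast at hx1
    exact ⟨hx, by lia, by lia⟩
  have hcols : ∀ s, ∃ y, t₀ ≤ s → s < t → column s y K ⊆ U t := by
    intro s
    by_cases hs : t₀ ≤ s ∧ s < t
    · obtain ⟨y, hy⟩ := exists_column_subset_preRect M n k hc (t := s) (by lia) hs.2 hseg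
      exact ⟨y, fun _ _ x hx => ⟨hy hx, hx.1.symm ▸ hs.1, hx.1.symm ▸ hs.2⟩⟩
    · exact ⟨0, fun h h' => absurd ⟨h, h'⟩ hs⟩
  choose y hy using hcols
  have hfin' : (U t ∪ column t b (K + 1)).Finite := (hUfin t).union (column_finite _ _ _)
  obtain ⟨p, hp, hper⟩ := exists_period_of_nonunique (hUfin t) (fun x hx => hx.2) hy h1
    (fun h => allExtendUniquely_of_complexity_le η h hfin' h3)
    (fun h => allExtendUniquely_of_complexity_le η h hfin' h2)
  exact ⟨t₀, t, p, ht, hp, hper⟩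

/-! ### Expansiveness of antiparallel directions. -/

/-- Under the complexity bound, one-sided expansiveness of a direction implies one-sided
expansiveness of the opposite direction. -/
theorem oneSidedExpansive_of_neg [Finite A] {η : (Fin 2 → ℤ) → A} {n k : ℕ}
    (hP : 2 * complexity η (rect n k) ≤ n * k) {v : Fin 2 → ℤ}
    (hexp : OneSidedExpansive η (-v)) : OneSidedExpansive η v := by
  obtain ⟨a, b, M, ha, hb, hray, hext⟩ := hexp
  by_contra hnon
  set ζ : (Fin 2 → ℤ) → A := fun x => η (M.val *ᵥ x) with hζ
  have hfin : (box a b ∪ {![-1, 0]}).Finite := by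
    refine Set.Finite.union ?_ (Set.finite_singleton _)
    refine (((Set.finite_Icc (0 : ℤ) a).prod (Set.finite_Icc (-(b : ℤ)) b)).image
      fun p => ![p.1, p.2]).subset ?_
    rintro x ⟨h0, h1, h2, h3⟩
    exact ⟨(x 0, x 1), ⟨⟨h0, h1⟩, ⟨h2, h3⟩⟩, by funext i; fin_cases i <;> rfl⟩
  have hleft : ∀ f ∈ orbitClosure ζ, ∀ g ∈ orbitClosure ζ,
      (∀ x : Fin 2 → ℤ, 0 ≤ x 0 → x 0 ≤ a → f x = g x) →
      ∀ x : Fin 2 → ℤ, x 0 = -1 → f x = g x := by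
    intro f hf g hg h x hx
    have := eq_of_allExtendUniquely hext hfin (shift_mem_orbitClosure hf ![0, x 1])
      (shift_mem_orbitClosure hg ![0, x 1])
      (fun y hy => h _ (by simpa using hy.1) (by simpa using hy.2.1)) ![-1, 0] (Or.inr rfl)
    have hx' : ![-1, 0] + ![0, x 1] = x := by
      funext i
      fin_cases i <;> simp [hx]
    simpa only [shift, hx'] using this
  -- Nonexpansiveness of `v` is tested with `-M`, which also has determinant one. The reflected
  -- boxes exhaust the half plane `x 0 ≤ 0`, and the ambiguous point becomes `(1, 0)`.
  have hnonunique : ∀ m : ℕ, ∃ u u', (∀ x ∈ {x | -x ∈ box (m + 1) (m + 1)},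
      ζ (x + u) = ζ (x + u')) ∧ ζ (![1, 0] + u) ≠ ζ (![1, 0] + u') := by
    intro m
    by_contra! hcon
    refine hnon ⟨m + 1, m + 1, ⟨-M.val, by simp [Matrix.det_neg]⟩, by lia, by lia, ?_, ?_⟩
    · rw [Matrix.neg_mulVec]
      exact sameRay_neg_swap.2 hray
    · rw [allExtendUniquely_iff]
      intro u u' huu
      have hneg : ∀ x w : Fin 2 → ℤ, (-M.val) *ᵥ (x + w) = M.val *ᵥ (-x + -w) := by
        intro x w
        rw [Matrix.neg_mulVec, ← Matrix.mulVec_neg, neg_add]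
      simp only [hneg] at huu ⊢
      have hz := hcon (-u) (-u') fun x hx => by
        simpa only [neg_neg] using huu (-x) hx
      rintro x (hx | rfl)
      · exact huu x hx
      · have h1 : -![(-1 : ℤ), 0] = ![1, 0] := by simp
        simpa only [h1] using hz
  obtain ⟨f, hf, g, hg, hfg, hne⟩ := exists_mem_orbitClosure ζ _ _ hnonunique
  obtain ⟨t₀, t₁, p, ht, hp, hper⟩ := exists_strip_period ζ M n k
    ((Nat.mul_le_mul_left 2 (complexity_preRect_le M n k η)).trans hP)
  refine hne (right_deterministic_of_left_deterministic hleft ht hp hper hf hg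
    (fun x hx => hfg x ?_) _ rfl)
  filter_upwards [Filter.eventually_ge_atTop ((x 0).natAbs + (x 1).natAbs)] with m hm
  simp only [box, Set.mem_ofPred_eq, Pi.neg_apply]
  push_cast
  lia

/-! ### Boundary edges in nonexpansive directions. -/

/-- A nonzero integer vector is a positive multiple of a vector that can be completed to a matrix of
determinant one. -/
theorem exists_eq_smul_of_ne_zero {v : Fin 2 → ℤ} (hv : v ≠ 0) :
    ∃ (p q r s d : ℤ), p * s - r * q = 1 ∧ 0 < d ∧ v = d • ![p, q] := by
  obtain ⟨d, hd⟩ : ∃ d : ℤ, d = Int.gcd (v 0) (v 1) := ⟨_, rfl⟩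
  have hd0 : 0 < d := by
    rw [hd, Int.natCast_pos, Int.gcd_pos_iff]
    by_contra! h
    exact hv (by funext i; fin_cases i; exacts [h.1, h.2])
  obtain ⟨p, hp⟩ : d ∣ v 0 := hd ▸ Int.gcd_dvd_left ..
  obtain ⟨q, hq⟩ : d ∣ v 1 := hd ▸ Int.gcd_dvd_right ..
  have hbez := Int.gcd_eq_gcd_ab (v 0) (v 1)
  refine ⟨p, q, -Int.gcdB (v 0) (v 1), Int.gcdA (v 0) (v 1), d, ?_, hd0, ?_⟩
  · have : d * (p * Int.gcdA (v 0) (v 1) - -Int.gcdB (v 0) (v 1) * q) = d * 1 := by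
      generalize Int.gcdA (v 0) (v 1) = α at *
      generalize Int.gcdB (v 0) (v 1) = β at *
      rw [← hd, hp, hq] at hbez
      linarith
    exact mul_left_cancel₀ hd0.ne' this
  · funext i
    fin_cases i
    · simpa using hp
    · simpa using hq

/-- If a finite set of integer points lies on the segment from `P` to `Q`, on which the linear form
`z ↦ p * z 1 - q * z 0` is constant, or strictly to the left of the line through it, so does its
hull. -/
theorem hull_subset_segment_union {S : Set (Fin 2 → ℤ)} {p q : ℤ} {P Q : Fin 2 → ℤ}
    (hPQ : p * Q 1 - q * Q 0 = p * P 1 - q * P 0)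
    (hS : ∀ x ∈ S, toReal x ∈ segment ℝ (toReal P) (toReal Q) ∨
      p * P 1 - q * P 0 < p * x 1 - q * x 0) :
    ∀ z ∈ hull S, z ∈ segment ℝ (toReal P) (toReal Q) ∨
      (p : ℝ) * P 1 - q * P 0 < p * z 1 - q * z 0 := by
  have hPQ' : (p : ℝ) * Q 1 - q * Q 0 = p * P 1 - q * P 0 := by exact_mod_cast hPQ
  have hseg : ∀ z ∈ segment ℝ (toReal P) (toReal Q),
      (p : ℝ) * z 1 - q * z 0 = p * P 1 - q * P 0 := by
    rintro _ ⟨a, b, -, -, hab, rfl⟩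
    simp only [Pi.add_apply, Pi.smul_apply, smul_eq_mul, toReal]
    linear_combination b * hPQ' + ((p : ℝ) * P 1 - q * P 0) * hab
  refine convexHull_min (t := {z | z ∈ segment ℝ (toReal P) (toReal Q) ∨
      (p : ℝ) * P 1 - q * P 0 < p * z 1 - q * z 0}) ?_ ?_
  · rintro _ ⟨x, hx, rfl⟩
    refine (hS x hx).imp id fun h => ?_
    simp only [toReal]
    exact_mod_cast h
  · intro x hx y hy a b ha hb hab
    have hx' : (p : ℝ) * P 1 - q * P 0 ≤ p * x 1 - q * x 0 :=
      hx.elim (fun h => (hseg x h).ge) le_of_lt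
    have hy' : (p : ℝ) * P 1 - q * P 0 ≤ p * y 1 - q * y 0 :=
      hy.elim (fun h => (hseg y h).ge) le_of_lt
    rcases ha.eq_or_lt with rfl | ha
    · obtain rfl : b = 1 := by linarith
      simpa using hy
    rcases hb.eq_or_lt with rfl | hb
    · obtain rfl : a = 1 := by linarith
      simpa using hx
    have hval : (p : ℝ) * (a • x + b • y) 1 - q * (a • x + b • y) 0 =
        a * (p * x 1 - q * x 0) + b * (p * y 1 - q * y 0) := by
      simp only [Pi.add_apply, Pi.smul_apply, smul_eq_mul]
      ring
    have hsum : (p : ℝ) * P 1 - q * P 0 =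
        a * (p * P 1 - q * P 0) + b * (p * P 1 - q * P 0) := by
      rw [← add_mul, hab, one_mul]
    rcases hx with hx | hx
    · rcases hy with hy | hy
      · exact Or.inl (convex_segment _ _ hx hy ha.le hb.le hab)
      · refine Or.inr ?_
        rw [hval, hsum]
        exact add_lt_add_of_le_of_lt (mul_le_mul_of_nonneg_left hx' ha.le)
          (mul_lt_mul_of_pos_left hy hb)
    · refine Or.inr ?_
      rw [hval, hsum]
      exact add_lt_add_of_lt_of_le (mul_lt_mul_of_pos_left hx ha)
        (mul_le_mul_of_nonneg_left hy' hb.le)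

/-- A point `P` generated by a finite set `S` whose other points lie strictly to the left of the
line through `P` of direction `(p, q)` makes this direction one-sided expansive. -/
theorem oneSidedExpansive_of_isGenerated {η : (Fin 2 → ℤ) → A} {S : Set (Fin 2 → ℤ)}
    (hfin : S.Finite) {P : Fin 2 → ℤ} (hP : P ∈ S) (hgen : IsGenerated η S P) {p q r s : ℤ}
    (hdet : p * s - r * q = 1)
    (hS : ∀ x ∈ S, x ≠ P → p * P 1 - q * P 0 < p * x 1 - q * x 0)
    {v : Fin 2 → ℤ} (hv : SameRay ℤ ![p, q] v) : OneSidedExpansive η v := by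
  let M : Matrix.SpecialLinearGroup (Fin 2) ℤ := ⟨!![r, -p; s, -q], by
    rw [Matrix.det_fin_two_of]; linarith⟩
  -- Lattice coordinates that send `P` to `(-1, 0)` and the line through `P` to the column `-1`; the
  -- other points of `S` then have first coordinate at least `0`.
  let w : (Fin 2 → ℤ) → Fin 2 → ℤ := fun x =>
    ![p * (x 1 - P 1) - q * (x 0 - P 0) - 1, r * (x 1 - P 1) - s * (x 0 - P 0)]
  have hw : ∀ x, M.val *ᵥ w x = x - P - ![r, s] := by
    intro x
    funext i
    fin_cases i
    · simp [mulVec_fin_two, M, w]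
      linear_combination (x 0 - P 0) * hdet
    · simp [mulVec_fin_two, M, w]
      linear_combination (x 1 - P 1) * hdet
  obtain ⟨B, hB⟩ := (hfin.image fun x => |w x 0| + |w x 1|).bddAbove
  have hB' : ∀ x ∈ S, |w x 0| + |w x 1| ≤ B := fun x hx => hB ⟨x, hx, rfl⟩
  refine ⟨B.toNat + 1, B.toNat + 1, M, by lia, by lia, ?_, ?_⟩
  · convert hv using 1
    funext i
    fin_cases i <;> simp [mulVec_fin_two, M]
  rw [allExtendUniquely_iff]
  intro u u' huu
  have hgen' := (allExtendUniquely_iff η _).1 hgen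
    (M.val *ᵥ u - P - ![r, s]) (M.val *ᵥ u' - P - ![r, s])
  have htr : ∀ x z : Fin 2 → ℤ, x + (M.val *ᵥ z - P - ![r, s]) = M.val *ᵥ (w x + z) := by
    intro x z
    rw [Matrix.mulVec_add, hw]
    abel
  simp only [htr] at hgen'
  have hwP : w P = ![-1, 0] := by simp [w]
  have := hgen' (fun x hx => huu (w x) ?_) P hP
  · rintro x (hx | rfl)
    · exact huu x hx
    · rwa [hwP] at this
  · have h1 := hS x hx.1 hx.2
    have h2 := hB' x hx.1
    have h3 := le_abs_self (w x 0)
    have h4 := abs_le.1 (le_refl |w x 1|)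
    have h5 := abs_nonneg (w x 0)
    have h6 := abs_nonneg (w x 1)
    have h7 : 0 ≤ w x 0 := by
      simp only [w, Matrix.cons_val_zero]
      linarith
    refine ⟨h7, ?_, ?_, ?_⟩ <;> push_cast <;> lia

/-- A weak generating set has a boundary edge in every one-sided nonexpansive direction. -/
theorem exists_isBoundaryEdge {η : (Fin 2 → ℤ) → A} {S : Set (Fin 2 → ℤ)}
    (hS : IsWeakGenerating η S) {v : Fin 2 → ℤ} (hv : v ≠ 0) (hℓ : OneSidedNonexpansive η v) :
    ∃ P Q : Fin 2 → ℤ, IsBoundaryEdge S P Q ∧ SameRay ℤ (Q - P) v := by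
  obtain ⟨hfin, hne, -, hgen⟩ := hS
  obtain ⟨p, q, r, s, d, hdet, hd, rfl⟩ := exists_eq_smul_of_ne_zero hv
  -- The form `φ` measures how far left of the direction `(p, q)` a point lies, and `ψ` its position
  -- along it, with `ψ = 1` at `(p, q)`. The points `P` and `Q` below are the ends of the face where
  -- `φ` is minimal.
  let φ : (Fin 2 → ℤ) → ℤ := fun x => p * x 1 - q * x 0
  let ψ : (Fin 2 → ℤ) → ℤ := fun x => s * x 0 - r * x 1
  have hline : ∀ x y, φ x = φ y → x - y = (ψ x - ψ y) • ![p, q] := by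
    intro x y hxy
    simp only [φ] at hxy
    funext i
    fin_cases i
    · simp [ψ]
      linear_combination -(x 0 - y 0) * hdet + r * hxy
    · simp [ψ]
      linear_combination -(x 1 - y 1) * hdet + s * hxy
  obtain ⟨x₀, hx₀, hmin⟩ := Set.exists_min_image S φ hfin hne
  have hFfin : {x | x ∈ S ∧ φ x = φ x₀}.Finite := hfin.subset fun x hx => hx.1
  obtain ⟨P, ⟨hPS, hPφ⟩, hPmin⟩ := Set.exists_min_image _ ψ hFfin ⟨x₀, hx₀, rfl⟩
  obtain ⟨Q, ⟨hQS, hQφ⟩, hQmax⟩ := Set.exists_max_image _ ψ hFfin ⟨x₀, hx₀, rfl⟩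
  have hc : 0 ≤ ψ Q - ψ P := sub_nonneg.2 (hPmin Q ⟨hQS, hQφ⟩)
  have hQP : Q - P = (ψ Q - ψ P) • ![p, q] := hline Q P (hQφ.trans hPφ.symm)
  have hdich : ∀ x ∈ S, toReal x ∈ segment ℝ (toReal P) (toReal Q) ∨ φ P < φ x := by
    intro x hx
    rcases (hmin x hx).lt_or_eq with h | h
    · exact Or.inr (by rwa [hPφ])
    left
    have h0 : 0 ≤ ψ x - ψ P := sub_nonneg.2 (hPmin x ⟨hx, h.symm⟩)
    have h1 : ψ x - ψ P ≤ ψ Q - ψ P := sub_le_sub_right (hQmax x ⟨hx, h.symm⟩) _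
    have hxP := hline x P (h.symm.trans hPφ.symm)
    rcases hc.eq_or_lt with hc | hc
    · have : ψ x - ψ P = 0 := by lia
      rw [this, zero_smul, sub_eq_zero] at hxP
      rw [hxP]
      exact left_mem_segment _ _ _
    rw [segment_eq_image']
    refine ⟨((ψ x - ψ P : ℤ) : ℝ) / ((ψ Q - ψ P : ℤ) : ℝ), ⟨?_, ?_⟩, ?_⟩
    · have : (0 : ℝ) ≤ ((ψ x - ψ P : ℤ) : ℝ) := by exact_mod_cast h0
      have : (0 : ℝ) < ((ψ Q - ψ P : ℤ) : ℝ) := by exact_mod_cast hc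
      positivity
    · rw [div_le_one (by exact_mod_cast hc)]
      exact_mod_cast h1
    · have hc' : ((ψ Q - ψ P : ℤ) : ℝ) ≠ 0 := by exact_mod_cast hc.ne'
      have hQP' : ∀ i, (Q i : ℝ) - P i = ((ψ Q - ψ P : ℤ) : ℝ) * (![p, q] i : ℤ) := fun i => by
        exact_mod_cast congrFun hQP i
      have hxP' : ∀ i, (x i : ℝ) - P i = ((ψ x - ψ P : ℤ) : ℝ) * (![p, q] i : ℤ) := fun i => by
        exact_mod_cast congrFun hxP i
      funext i
      simp only [toReal, Pi.add_apply, Pi.smul_apply, Pi.sub_apply, smul_eq_mul]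
      rw [hQP', ← mul_assoc, div_mul_cancel₀ _ hc', ← hxP']
      ring
  have hhull := hull_subset_segment_union (hQφ.trans hPφ.symm) hdich
  have hmem : ∀ x ∈ S, toReal x ∈ hull S := fun x hx => subset_convexHull ℝ _ ⟨x, hx, rfl⟩
  -- If the face is a single point, it is a vertex, hence generated, and the direction would be
  -- expansive.
  by_cases hPQ : P = Q
  · refine absurd (oneSidedExpansive_of_isGenerated hfin hPS (hgen P ?_) hdet ?_ ?_) hℓ
    · subst hPQ
      simp only [segment_same, Set.mem_singleton_iff] at hhull
      refine ⟨hmem P hPS, ?_⟩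
      rintro y hy z hz ⟨a, b, ha, hb, hab, habP⟩
      have h0 := congrFun habP 0
      have h1 := congrFun habP 1
      simp only [Pi.add_apply, Pi.smul_apply, smul_eq_mul, toReal] at h0 h1
      have hval : (p : ℝ) * P 1 - q * P 0 =
          a * (p * y 1 - q * y 0) + b * (p * z 1 - q * z 0) := by
        rw [← h0, ← h1]
        ring
      have hsum : (p : ℝ) * P 1 - q * P 0 =
          a * (p * P 1 - q * P 0) + b * (p * P 1 - q * P 0) := by
        rw [← add_mul, hab, one_mul]
      rcases hhull y hy with h | h
      · exact h
      have h2 : (p : ℝ) * P 1 - q * P 0 ≤ p * z 1 - q * z 0 := by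
        rcases hhull z hz with rfl | h
        · exact le_rfl
        · exact h.le
      have h3 := mul_lt_mul_of_pos_left h ha
      have h4 := mul_le_mul_of_nonneg_left h2 hb.le
      linarith
    · intro x hx hxP
      rcases hdich x hx with h | h
      · rw [← hPQ, segment_same, Set.mem_singleton_iff] at h
        exact absurd (funext fun i => Int.cast_injective (congrFun h i)) hxP
      · exact h
    · exact SameRay.sameRay_pos_smul_right _ hd
  have hc' : 0 < ψ Q - ψ P := by
    refine hc.lt_of_ne fun h => hPQ ?_
    rw [← h, zero_smul, sub_eq_zero] at hQP
    exact hQP.symm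
  have hcross : ∀ z, cross (toReal Q - toReal P) (z - toReal P) =
      ((ψ Q - ψ P : ℤ) : ℝ) * ((p * z 1 - q * z 0) - (p * P 1 - q * P 0)) := by
    intro z
    have h0 : (Q 0 : ℝ) - P 0 = ((ψ Q - ψ P : ℤ) : ℝ) * p := by exact_mod_cast congrFun hQP 0
    have h1 : (Q 1 : ℝ) - P 1 = ((ψ Q - ψ P : ℤ) : ℝ) * q := by exact_mod_cast congrFun hQP 1
    simp only [cross, Pi.sub_apply, toReal]
    rw [h0, h1]
    ring
  have hcpos : (0 : ℝ) < ((ψ Q - ψ P : ℤ) : ℝ) := by exact_mod_cast hc'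
  have hseg : ∀ z ∈ segment ℝ (toReal P) (toReal Q),
      cross (toReal Q - toReal P) (z - toReal P) = 0 := by
    rw [segment_eq_image']
    rintro _ ⟨θ, -, rfl⟩
    simp only [cross, add_sub_cancel_left, Pi.smul_apply, smul_eq_mul]
    ring
  refine ⟨P, Q, ⟨hPQ, fun z hz => ?_, ?_⟩, ?_⟩
  · rcases hhull z hz with h | h
    · exact (hseg z h).ge
    · rw [hcross]
      exact mul_nonneg hcpos.le (sub_nonneg.2 h.le)
  · ext z
    constructor
    · rintro ⟨hz, h0⟩
      refine (hhull z hz).resolve_right fun h => ?_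
      rw [hcross] at h0
      exact (mul_pos hcpos (sub_pos.2 h)).ne' h0
    · intro hz
      exact ⟨(convex_convexHull ℝ _).segment_subset (hmem P hPS) (hmem Q hQS) hz, hseg z hz⟩
  · rw [hQP]
    exact (SameRay.refl _).pos_smul_left hc' |>.pos_smul_right hd

end PlaneColoring

theorem lemma4p13 {A : Type*} [Finite A] (η : (Fin 2 → ℤ) → A) (n k : ℕ)
    (hP : (complexity η (rect n k) : ℝ) ≤ (n : ℝ) * (k : ℝ) / 2)
    (v : Fin 2 → ℤ) (hv : v ≠ 0) (hℓ : OneSidedNonexpansive η v) :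
    OneSidedNonexpansive η (-v) ∧
    ∀ S : Set (Fin 2 → ℤ), IsGenerating η S →
      (∃ p q : Fin 2 → ℤ, IsBoundaryEdge S p q ∧ SameRay ℤ (q - p) v) ∧
      (∃ p q : Fin 2 → ℤ, IsBoundaryEdge S p q ∧ SameRay ℤ (q - p) (-v)) := by
  have hP' : 2 * complexity η (rect n k) ≤ n * k := by
    rw [le_div_iff₀ two_pos, mul_comm] at hP
    exact_mod_cast hP
  have hneg : OneSidedNonexpansive η (-v) := fun h => hℓ (oneSidedExpansive_of_neg hP' h)
  exact ⟨hneg, fun S hS => ⟨exists_isBoundaryEdge hS.1 hv hℓ,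
    exists_isBoundaryEdge hS.1 (neg_ne_zero.2 hv) hneg⟩⟩
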